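/- Let $m \ge 0$, $[m]=\{1,\dots,m\}$, and let $L_1, L_2 \subseteq \mathbb{C}^m$ be linear subspaces, neither of which is contained in any coordinate hyperplane $\{x \in \mathbb{C}^m : x_e = 0\}$, $e \in [m]$. For $i=1,2$ and $F \subseteq [m]$ let $r_i(F)$ be the rank of $F$ in the linear matroid of $L_i$, i.e. the dimension of the span of the coordinate functions $x_e|_{L_i}$, $e \in F$, in the dual space $L_i^*$ (equivalently, the rank of the rows indexed by $F$ of a matrix whose columns form a basis of $L_i$). Let $L_1 * L_2 \subseteq \mathbb{C}^m$ be the Hadamard product, i.e. the Zariski closure of $\{(x_1y_1,\dots,x_my_m) : x \in L_1,\ y \in L_2\}$, which is an irreducible variety. For an irreducible variety $V \subseteq \mathbb{C}^m$, the algebraic matroid $\mathcal{M}(V)$ is the matroid on $[m]$ whose independent sets are the $E \subseteq [m]$ such that the coordinate projection $\pi_E(V)$ is Zariski dense in $\mathbb{C}^E$. For a set function $f \colon 2^{[m]} \to \mathbb{Z}$, the Dilworth truncation is $$f^{\mathrm D}(F) = \min\Big\{\textstyle\sum_{i=1}^t f(F_i) : \{F_1,\dots,F_t\} \text{ is a partition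 of } F \text{ into nonempty sets}\Big\},$$ with $f^{\mathrm D}(\emptyset)=0$. If $f$ is monotone, submodular and non-negative on nonempty sets, the matroid $\mathcal{M}_f$ induced by $f$ is the matroid on $[m]$ whose independent sets are the $F \subseteq [m]$ with $|I| \le f^{\mathrm D}(I)$ for all $I \subseteq F$. Then $$\mathcal{M}(L_1 * L_2) = \mathcal{M}_{r_1+r_2-1},$$ and the rank in this matroid of every nonempty $F \subseteq [m]$ is $$(r_1+r_2-1)^{\mathrm D}(F) = \min\Big\{\textstyle\sum_{i=1}^t \big(r_1(F_i)+r_2(F_i)-1\big) : \{F_1,\dots,F_t\} \text{ is a partition of } F \text{ into nonempty sets}\Big\}$$ (the rank of the empty set being $0$). -/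

import Mathlib

open scoped Finset

/-! ### Monotone submodular functions, Dilworth truncation, induced matroid -/

/-- `f` is a monotone submodular integer-valued set function.
No condition is put on the value at the empty set. -/
structure IsMonotoneSubmodular {m : ℕ} (f : Finset (Fin m) → ℤ) : Prop where
  mono : ∀ X Y, X ⊆ Y → f X ≤ f Y
  submodular : ∀ X Y, f (X ∪ Y) + f (X ∩ Y) ≤ f X + f Y

/-- The Dilworth truncation of `f`: the minimum of `∑ f (Fᵢ)` over all partitions
`{F₁, …, Fₜ}` of `F` into nonempty parts. The only partition of the empty set is the one
without parts, so the value at the empty set is `0`. -/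
def dilworthTruncation {m : ℕ} (f : Finset (Fin m) → ℤ) (F : Finset (Fin m)) : ℤ :=
  (Finset.univ : Finset (Finpartition F)).inf' Finset.univ_nonempty
    (fun P => ∑ p ∈ P.parts, f p)

theorem card_le_dilworthTruncation_iff {m : ℕ} (f : Finset (Fin m) → ℤ) (F : Finset (Fin m)) :
    (∀ I ⊆ F, (#I : ℤ) ≤ dilworthTruncation f I) ↔
      ∀ I ⊆ F, I.Nonempty → (#I : ℤ) ≤ f I := by
  constructor
  · intro h I hI hne
    refine (h I hI).trans ?_
    refine (Finset.inf'_le _ (Finset.mem_univ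
      (Finpartition.indiscrete (a := I) hne.ne_empty))).trans ?_
    simp
  · intro h I hI
    refine Finset.le_inf' _ _ fun P _ => ?_
    rw [← P.sum_card_parts]
    push_cast
    refine Finset.sum_le_sum fun p hp => h p ((P.le hp).trans hI) ?_
    exact P.nonempty_of_mem_parts hp

/-- The augmentation property behind the matroid induced by `f`. -/
theorem IsMonotoneSubmodular.augment {m : ℕ} {f : Finset (Fin m) → ℤ}
    (hf : IsMonotoneSubmodular f) (A B : Finset (Fin m))
    (hA : ∀ I ⊆ A, I.Nonempty → (#I : ℤ) ≤ f I)
    (hB : ∀ I ⊆ B, I.Nonempty → (#I : ℤ) ≤ f I) (hAB : #A < #B) :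
    ∃ b ∈ B, b ∉ A ∧ ∀ I ⊆ insert b A, I.Nonempty → (#I : ℤ) ≤ f I := by
  classical
  by_contra! hcon
  let Tight : Finset (Fin m) → Prop := fun T => T ⊆ A ∧ T.Nonempty ∧ f T ≤ #T
  have hunion : ∀ T U, Tight T → Tight U → (T ∩ U).Nonempty → Tight (T ∪ U) := by
    rintro T U ⟨hTA, hT, hfT⟩ ⟨hUA, hU, hfU⟩ hTU
    refine ⟨Finset.union_subset hTA hUA, hT.mono Finset.subset_union_left, ?_⟩
    have h1 := hf.submodular T U
    have h2 := hA (T ∩ U) (Finset.inter_subset_left.trans hTA) hTU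
    have h3 := Finset.card_union_add_card_inter T U
    omega
  have hstep : ∀ b ∈ B, b ∉ A → ∃ T, Tight T ∧ f (insert b T) ≤ #T := by
    intro b hb hbA
    obtain ⟨I, hI, hIne, hlt⟩ := hcon b hb hbA
    have hbI : b ∈ I := by
      by_contra hbI
      have : I ⊆ A := fun x hx => by
        rcases Finset.mem_insert.1 (hI hx) with rfl | h
        · exact absurd hx hbI
        · exact h
      have := hA I this hIne
      omega
    have h1 : (1 : ℤ) ≤ f I := by
      have h := hB {b} (by simpa using hb) (by simp)
      have h' := hf.mono {b} I (by simpa using hbI)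
      simp at h
      omega
    have hcard := Finset.card_erase_add_one hbI
    have hsub : I.erase b ⊆ A := by
      intro x hx
      obtain ⟨h1, h2⟩ := Finset.mem_erase.1 hx
      exact (Finset.mem_insert.1 (hI h2)).resolve_left h1
    refine ⟨I.erase b, ⟨hsub, ?_, ?_⟩, ?_⟩
    · rw [← Finset.card_pos]; omega
    · have := hf.mono _ _ (Finset.erase_subset b I)
      omega
    · rw [Finset.insert_erase hbI]; omega
  let D : Finset (Finset (Fin m)) :=
    A.powerset.filter fun T => Tight T ∧ ∀ U, Tight U → T ⊆ U → U = T
  have hmax : ∀ T, Tight T → ∃ U ∈ D, T ⊆ U := by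
    intro T hT
    obtain ⟨U, hTU, hU⟩ := Finset.exists_le_maximal (A.powerset.filter Tight)
      (a := T) (by simp [hT, hT.1])
    have hU1 : Tight U := (Finset.mem_filter.1 hU.1).2
    refine ⟨U, ?_, hTU⟩
    refine Finset.mem_filter.2 ⟨Finset.mem_powerset.2 hU1.1, hU1, fun W hW hUW => ?_⟩
    exact le_antisymm (hU.2 (Finset.mem_filter.2 ⟨Finset.mem_powerset.2 hW.1, hW⟩) hUW) hUW
  have hDT : ∀ U ∈ D, Tight U := fun U hU => (Finset.mem_filter.1 hU).2.1
  have hdisj : ∀ U ∈ D, ∀ W ∈ D, U ≠ W → Disjoint U W := by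
    intro U hU W hW hne
    rw [Finset.disjoint_iff_inter_eq_empty]
    by_contra h
    have ht := hunion U W (hDT U hU) (hDT W hW) (Finset.nonempty_iff_ne_empty.2 h)
    have e1 := (Finset.mem_filter.1 hU).2.2 _ ht Finset.subset_union_left
    have e2 := (Finset.mem_filter.1 hW).2.2 _ ht Finset.subset_union_right
    exact hne (e1.symm.trans e2)
  let S : Finset (Fin m) → Finset (Fin m) := fun U => (B \ A).filter fun b => f (insert b U) ≤ #U
  have hS : ∀ U ∈ D, f (U ∪ S U) ≤ #U := by
    intro U hU
    obtain ⟨hUA, hUne, hfU⟩ := hDT U hU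
    have key : ∀ S' : Finset (Fin m), S' ⊆ S U → f (U ∪ S') ≤ #U := by
      intro S'
      induction S' using Finset.induction_on with
      | empty => intro _; simpa using hfU
      | insert b S' hb ih =>
        intro hsub
        have h1 := ih ((Finset.subset_insert _ _).trans hsub)
        have h2 : f (insert b U) ≤ #U :=
          (Finset.mem_filter.1 (hsub (Finset.mem_insert_self b S'))).2
        have h3 := hf.submodular (U ∪ S') (insert b U)
        have h4 : U ∪ S' ∪ insert b U = U ∪ insert b S' := by
          ext x; simp; tauto
        have h5 : f U ≤ f ((U ∪ S') ∩ insert b U) := hf.mono _ _ (by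
          intro x hx; simp [hx])
        have h6 := hA U hUA hUne
        rw [h4] at h3
        omega
    exact key _ subset_rfl
  have hSB : ∀ U ∈ D, #(S U) ≤ #(U \ B) := by
    intro U hU
    obtain ⟨hUA, hUne, hfU⟩ := hDT U hU
    have hd : Disjoint (B ∩ U) (S U) := by
      rw [Finset.disjoint_left]
      intro x hx hx'
      exact (Finset.mem_sdiff.1 (Finset.mem_filter.1 hx').1).2 (hUA (Finset.mem_inter.1 hx).2)
    have h1 : #((B ∩ U) ∪ S U) ≤ #U := by
      rcases ((B ∩ U) ∪ S U).eq_empty_or_nonempty with h | h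
      · simp [h]
      · have h2 : (#((B ∩ U) ∪ S U) : ℤ) ≤ f ((B ∩ U) ∪ S U) := hB _ (Finset.union_subset Finset.inter_subset_left
          ((Finset.filter_subset _ _).trans Finset.sdiff_subset)) h
        have h3 := hf.mono _ _ (Finset.union_subset_union_left
          (t := S U) (Finset.inter_subset_right (s₁ := B) (s₂ := U)))
        have h4 := hS U hU
        omega
    rw [Finset.card_union_of_disjoint hd] at h1
    have h5 := Finset.card_sdiff_add_card_inter U B
    rw [Finset.inter_comm] at h5
    omega
  have hcover : B \ A ⊆ D.biUnion S := by
    intro b hb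
    obtain ⟨hbB, hbA⟩ := Finset.mem_sdiff.1 hb
    obtain ⟨T, hT, hbT⟩ := hstep b hbB hbA
    obtain ⟨U, hU, hTU⟩ := hmax T hT
    refine Finset.mem_biUnion.2 ⟨U, hU, Finset.mem_filter.2 ⟨hb, ?_⟩⟩
    obtain ⟨hUA, hUne, hfU⟩ := hDT U hU
    have h1 := hf.submodular (insert b T) U
    have h2 : insert b T ∪ U = insert b U := by
      rw [Finset.insert_union, Finset.union_eq_right.2 hTU]
    have h3 : f T ≤ f (insert b T ∩ U) := hf.mono _ _ (by
      intro x hx; simp [hx, hTU hx])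
    have h4 := hA T hT.1 hT.2.1
    rw [h2] at h1
    omega
  have hfinal : #(B \ A) ≤ #(A \ B) := by
    calc #(B \ A) ≤ #(D.biUnion S) := Finset.card_le_card hcover
      _ ≤ ∑ U ∈ D, #(S U) := Finset.card_biUnion_le
      _ ≤ ∑ U ∈ D, #(U \ B) := Finset.sum_le_sum hSB
      _ = #(D.biUnion fun U => U \ B) := by
        rw [Finset.card_biUnion]
        intro U hU W hW hne
        exact (hdisj U hU W hW hne).mono Finset.sdiff_subset Finset.sdiff_subset
      _ ≤ #(A \ B) := by
        refine Finset.card_le_card (Finset.biUnion_subset.2 fun U hU => ?_)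
        exact Finset.sdiff_subset_sdiff (hDT U hU).1 subset_rfl
  have e1 := Finset.card_sdiff_add_card_inter A B
  have e2 := Finset.card_sdiff_add_card_inter B A
  rw [Finset.inter_comm] at e2
  omega

/-- The matroid induced by a monotone submodular function `f`: a set is independent
iff each of its subsets `I` satisfies `|I| ≤ fᴰ(I)`, where `fᴰ` is the Dilworth truncation
of `f`. -/
def inducedMatroid {m : ℕ} (f : Finset (Fin m) → ℤ) (hf : IsMonotoneSubmodular f) :
    Matroid (Fin m) :=
  (IndepMatroid.ofFinset Set.univ
    (fun F : Finset (Fin m) => ∀ I ⊆ F, (#I : ℤ) ≤ dilworthTruncation f I)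
    (by
      rw [card_le_dilworthTruncation_iff]
      intro I hI hne
      exact absurd (Finset.subset_empty.1 hI) hne.ne_empty)
    (fun _ _ hJ hIJ K hK => hJ K (hK.trans hIJ))
    (by
      intro I J hI hJ hIJ
      simp only [card_le_dilworthTruncation_iff] at hI hJ ⊢
      exact hf.augment I J hI hJ hIJ)
    (fun _ _ => Set.subset_univ _)).matroid

theorem inducedMatroid_indep_iff {m : ℕ} (f : Finset (Fin m) → ℤ) (hf : IsMonotoneSubmodular f)
    (F : Finset (Fin m)) :
    (inducedMatroid f hf).Indep (F : Set (Fin m)) ↔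
      ∀ I ⊆ F, (#I : ℤ) ≤ dilworthTruncation f I := by
  unfold inducedMatroid
  rw [IndepMatroid.matroid_indep_iff, IndepMatroid.ofFinset_indep]

/-! ### Varieties and algebraic matroids -/

/-- The closure of `S` in the Zariski topology on affine space `ℂ^σ`. -/
def zariskiClosure {σ : Type*} (S : Set (σ → ℂ)) : Set (σ → ℂ) :=
  MvPolynomial.zeroLocus ℂ (MvPolynomial.vanishingIdeal ℂ S)

/-- An irreducible affine variety in `ℂ^σ`: a Zariski closed set whose ideal is prime. -/
structure IsIrreducibleVariety {σ : Type*} (V : Set (σ → ℂ)) : Prop where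
  closed : zariskiClosure V = V
  prime : (MvPolynomial.vanishingIdeal ℂ V).IsPrime

theorem vanishingIdeal_zariskiClosure {σ : Type*} (S : Set (σ → ℂ)) :
    MvPolynomial.vanishingIdeal ℂ (zariskiClosure S) = MvPolynomial.vanishingIdeal ℂ S :=
  le_antisymm
    (MvPolynomial.vanishingIdeal_anti_mono (MvPolynomial.zeroLocus_vanishingIdeal_le S))
    (MvPolynomial.le_vanishingIdeal_zeroLocus _)

theorem zariskiClosure_eq_univ_iff {σ : Type*} (S : Set (σ → ℂ)) :
    zariskiClosure S = Set.univ ↔ MvPolynomial.vanishingIdeal ℂ S = ⊥ := by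
  constructor
  · intro h
    rw [← vanishingIdeal_zariskiClosure, h, eq_bot_iff]
    intro p hp
    refine MvPolynomial.funext fun x => ?_
    simpa [MvPolynomial.aeval_eq_eval] using hp x trivial
  · intro h
    rw [zariskiClosure, h, MvPolynomial.zeroLocus_bot, Set.top_eq_univ]

/-- The coordinate subsets onto which an irreducible variety projects dominantly are the
independent sets of a matroid. -/
theorem exists_algebraicMatroid {m : ℕ} (V : Set (Fin m → ℂ)) (hV : IsIrreducibleVariety V) :
    ∃ M : Matroid (Fin m), Set.univ = M.E ∧
      ∀ E : Set (Fin m), M.Indep E ↔ zariskiClosure (E.domRestrict '' V) = Set.univ := by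
  have := hV.prime
  let A := MvPolynomial (Fin m) ℂ ⧸ MvPolynomial.vanishingIdeal ℂ V
  let x : Fin m → A := fun e => Ideal.Quotient.mk _ (MvPolynomial.X e)
  refine ⟨(AlgebraicIndependent.matroid ℂ A).comap x, ?_, fun E => ?_⟩
  · simp
  · rw [zariskiClosure_eq_univ_iff, Matroid.comap_indep_iff,
      AlgebraicIndependent.matroid_indep_iff]
    have h1 : AlgebraicIndependent ℂ (fun e : E => x e) ↔
        MvPolynomial.vanishingIdeal ℂ (E.domRestrict '' V) = ⊥ := by
      rw [algebraicIndependent_iff, eq_bot_iff]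
      have h2 : ∀ p : MvPolynomial E ℂ, MvPolynomial.aeval (fun e : E => x e) p = 0 ↔
          p ∈ MvPolynomial.vanishingIdeal ℂ (E.domRestrict '' V) := by
        intro p
        have h3 : MvPolynomial.aeval (fun e : E => x e) p =
            Ideal.Quotient.mkₐ ℂ (MvPolynomial.vanishingIdeal ℂ V)
              (MvPolynomial.rename Subtype.val p) := by
          rw [← AlgHom.comp_apply]
          congr 1
          refine MvPolynomial.algHom_ext fun e => ?_
          simp [x]
        rw [h3, Ideal.Quotient.mkₐ_eq_mk, Ideal.Quotient.eq_zero_iff_mem,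
          MvPolynomial.mem_vanishingIdeal_iff, MvPolynomial.mem_vanishingIdeal_iff,
          Set.forall_mem_image]
        refine forall₂_congr fun v _ => ?_
        rw [MvPolynomial.aeval_rename]
        rfl
      exact ⟨fun h p hp => h p ((h2 p).2 hp), fun h p hp => h ((h2 p).1 hp)⟩
    rw [← h1]
    constructor
    · rintro ⟨h, hinj⟩
      exact (algebraicIndependent_image hinj).2 h
    · intro h
      have hinj : Set.InjOn x E := Set.injOn_iff_injective.2 h.injective
      exact ⟨(algebraicIndependent_image hinj).1 h, hinj⟩

/-- The algebraic matroid of an irreducible variety `V ⊆ ℂ^m`: a set `E` of coordinates is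
independent iff the Zariski closure of the projection of `V` to `ℂ^E` is all of `ℂ^E`. -/
def algebraicMatroid {m : ℕ} (V : Set (Fin m → ℂ)) (hV : IsIrreducibleVariety V) :
    Matroid (Fin m) :=
  Matroid.ofExistsMatroid Set.univ (fun E => zariskiClosure (E.domRestrict '' V) = Set.univ)
    (exists_algebraicMatroid V hV)

theorem algebraicMatroid_indep_iff {m : ℕ} (V : Set (Fin m → ℂ)) (hV : IsIrreducibleVariety V)
    (E : Set (Fin m)) :
    (algebraicMatroid V hV).Indep E ↔ zariskiClosure (E.domRestrict '' V) = Set.univ :=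
  Iff.rfl

/-- The Hadamard product of two varieties: the Zariski closure of the set of
coordinatewise products. -/
def hadamardProduct {m : ℕ} (V W : Set (Fin m → ℂ)) : Set (Fin m → ℂ) :=
  zariskiClosure {z | ∃ x ∈ V, ∃ y ∈ W, z = fun j => x j * y j}

/-- The Hadamard product of two linear spaces is irreducible. -/
theorem hadamardProduct_irreducible {m : ℕ} (L₁ L₂ : Submodule ℂ (Fin m → ℂ)) :
    IsIrreducibleVariety (hadamardProduct (L₁ : Set (Fin m → ℂ)) (L₂ : Set (Fin m → ℂ))) := by
  constructor
  · unfold hadamardProduct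
    rw [zariskiClosure, vanishingIdeal_zariskiClosure]
    rfl
  · rw [hadamardProduct, vanishingIdeal_zariskiClosure]
    refine ⟨?_, ?_⟩
    · rw [Ne, Ideal.eq_top_iff_one]
      intro h
      have := h (fun j => (0 : Fin m → ℂ) j * (0 : Fin m → ℂ) j)
        ⟨0, L₁.zero_mem, 0, L₂.zero_mem, rfl⟩
      simp at this
    · intro p q hpq
      by_contra! hcon
      obtain ⟨hp, hq⟩ := hcon
      rw [MvPolynomial.mem_vanishingIdeal_iff] at hp hq
      push Not at hp hq
      obtain ⟨_, ⟨x, hx, y, hy, rfl⟩, hp⟩ := hp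
      obtain ⟨_, ⟨x', hx', y', hy', rfl⟩, hq⟩ := hq
      let g : Fin m → Polynomial ℂ := fun j =>
        (Polynomial.C (x j) + Polynomial.X * Polynomial.C (x' j - x j)) *
          (Polynomial.C (y j) + Polynomial.X * Polynomial.C (y' j - y j))
      have hg : ∀ (r : MvPolynomial (Fin m) ℂ) (t : ℂ),
          (MvPolynomial.aeval g r).eval t =
            MvPolynomial.aeval (fun j => (x + t • (x' - x)) j * (y + t • (y' - y)) j) r := by
        intro r t
        have := MvPolynomial.comp_aeval_apply g (Polynomial.aeval t) r
        rw [Polynomial.coe_aeval_eq_eval] at this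
        rw [this]
        congr 2
        funext j
        simp [g]
      have hprod : MvPolynomial.aeval g p * MvPolynomial.aeval g q = 0 := by
        rw [← map_mul]
        refine Polynomial.funext fun t => ?_
        rw [hg, Polynomial.eval_zero]
        exact hpq _ ⟨_, L₁.add_mem hx (L₁.smul_mem t (L₁.sub_mem hx' hx)), _,
          L₂.add_mem hy (L₂.smul_mem t (L₂.sub_mem hy' hy)), rfl⟩
      rcases mul_eq_zero.1 hprod with h | h
      · refine hp ?_
        have := hg p 0
        rw [h] at this
        simpa using this.symm
      · refine hq ?_
        have := hg q 1
        rw [h] at this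
        simpa using this.symm

/-! ### Linear matroids -/

/-- The coordinate hyperplane `{x | x e = 0}` of `ℂ^m`. -/
def coordinateHyperplane {m : ℕ} (e : Fin m) : Submodule ℂ (Fin m → ℂ) :=
  LinearMap.ker (LinearMap.proj e)

/-- The coordinate function `x ↦ x e` restricted to `L`. With respect to a basis of `L`, it is
the row with index `e` of the matrix whose columns are the basis vectors. -/
def coordinateForm {m : ℕ} (L : Submodule ℂ (Fin m → ℂ)) (e : Fin m) : Module.Dual ℂ L :=
  (LinearMap.proj e : (Fin m → ℂ) →ₗ[ℂ] ℂ).domRestrict L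

/-- The rank function of the linear matroid of `L`, that is of the matroid on the coordinates
that is represented by the vectors `coordinateForm L e`: the dimension of their span. -/
noncomputable def linearRank {m : ℕ} (L : Submodule ℂ (Fin m → ℂ)) (F : Finset (Fin m)) : ℕ :=
  Module.finrank ℂ (Submodule.span ℂ (coordinateForm L '' (F : Set (Fin m))))

theorem isMonotoneSubmodular_rank_add_rank_sub_one {m : ℕ} (L₁ L₂ : Submodule ℂ (Fin m → ℂ)) :
    IsMonotoneSubmodular (fun F => (linearRank L₁ F : ℤ) + (linearRank L₂ F : ℤ) - 1) := by
  have hmono : ∀ (L : Submodule ℂ (Fin m → ℂ)) (X Y : Finset (Fin m)), X ⊆ Y →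
      linearRank L X ≤ linearRank L Y := fun L X Y h =>
    Submodule.finrank_mono (Submodule.span_mono (Set.image_mono (Finset.coe_subset.2 h)))
  have hsub : ∀ (L : Submodule ℂ (Fin m → ℂ)) (X Y : Finset (Fin m)),
      linearRank L (X ∪ Y) + linearRank L (X ∩ Y) ≤ linearRank L X + linearRank L Y := by
    intro L X Y
    unfold linearRank
    rw [← Submodule.finrank_sup_add_finrank_inf_eq
      (Submodule.span ℂ (coordinateForm L '' (X : Set (Fin m)))), Finset.coe_union, Set.image_union,
      Submodule.span_union]
    refine Nat.add_le_add_left ?_ _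
    exact Submodule.finrank_mono (le_inf (Submodule.span_mono (Set.image_mono (by simp)))
      (Submodule.span_mono (Set.image_mono (by simp))))
  refine ⟨fun X Y h => ?_, fun X Y => ?_⟩
  · have h1 := hmono L₁ X Y h
    have h2 := hmono L₂ X Y h
    omega
  · have h1 := hsub L₁ X Y
    have h2 := hsub L₂ X Y
    omega

/-!
Let `x` and `y` be generic points of `L₁` and `L₂`. A set `F` is independent in the algebraic
matroid of `L₁ * L₂` if and only if the products `x e * y e`, `e ∈ F`, are algebraically
independent, and this has to be compared with `#I ≤ r₁ I + r₂ I - 1` for nonempty `I ⊆ F`.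

The inequality is necessary because the products lie in the image of a space of dimension
`r₁ I + r₂ I` whose fibres contain the orbits of the scaling `(x, y) ↦ (c x, c⁻¹ y)`.

For sufficiency, suppose that the differentials of the products satisfy a linear relation `q` over
the functions of `(x, y)`. By induction on `F`, a relation that vanishes at one element is
zero, so assume that no `q e` is zero. Since `#F < r₁ F + r₂ F`, some nonzero direction `(X, Y)`
satisfies `X e₀ = 0` and is tangent to the fibre of `x e * y e` for all `e ≠ e₀`, and by the
relation `q` also for `e₀`. Differentiating `q`, applied to `(X, Y)`, in an arbitrary direction
gives a relation with coefficients `q e * X e / x e`. It vanishes at `e₀`, hence everywhere, so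
`X = 0` and then `Y = 0`, a contradiction. The Jacobian criterion now yields algebraic
independence.

For the rank formula, let `A` be a basis of `F` in the matroid induced by `f`. By submodularity the
maximal tight subsets of `A` are disjoint, and their closures cover all non-loops of `F`; this
partition attains the bound `#A`.
-/

section DilworthTruncation

variable {m : ℕ} {f : Finset (Fin m) → ℤ} {A C F T U : Finset (Fin m)}

theorem IsMonotoneSubmodular.monotone (hf : IsMonotoneSubmodular f) : Monotone f :=
  fun X Y => hf.mono X Y

theorem inducedMatroid_indep_iff_forall_card_le (hf : IsMonotoneSubmodular f) :
    (inducedMatroid f hf).Indep (A : Set (Fin m)) ↔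
      ∀ I ⊆ A, I.Nonempty → (#I : ℤ) ≤ f I := by
  rw [inducedMatroid_indep_iff, card_le_dilworthTruncation_iff]

theorem dilworthTruncation_le_sum_parts (f : Finset (Fin m) → ℤ) (P : Finpartition F) :
    dilworthTruncation f F ≤ ∑ p ∈ P.parts, f p :=
  Finset.inf'_le _ (Finset.mem_univ P)

theorem exists_dilworthTruncation_eq_sum_parts (f : Finset (Fin m) → ℤ) (F : Finset (Fin m)) :
    ∃ P : Finpartition F, dilworthTruncation f F = ∑ p ∈ P.parts, f p := by
  obtain ⟨P, -, hP⟩ := Finset.exists_mem_eq_inf' (Finset.univ_nonempty (α := Finpartition F))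
    fun P => ∑ p ∈ P.parts, f p
  exact ⟨P, hP⟩

theorem dilworthTruncation_le_sum_singleton (f : Finset (Fin m) → ℤ) (F : Finset (Fin m)) :
    dilworthTruncation f F ≤ ∑ b ∈ F, f {b} :=
  (dilworthTruncation_le_sum_parts f ⊥).trans_eq (by simp [Finpartition.parts_bot])

theorem dilworthTruncation_le_sdiff_add (hf : Monotone f) (hC : 0 ≤ f C)
    (F : Finset (Fin m)) : dilworthTruncation f F ≤ dilworthTruncation f (F \ C) + f C := by
  rcases (F ∩ C).eq_empty_or_nonempty with hFC | hFC
  · rw [Finset.sdiff_eq_self_of_disjoint (Finset.disjoint_iff_inter_eq_empty.2 hFC)]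
    exact le_add_of_nonneg_right hC
  obtain ⟨P, hP⟩ := exists_dilworthTruncation_eq_sum_parts f (F \ C)
  have hdisj : Disjoint (F \ C) (F ∩ C) := Finset.disjoint_sdiff_inter F C
  have hnotMem : F ∩ C ∉ P.parts := fun h =>
    hFC.ne_empty (disjoint_self.1 (hdisj.mono_left (P.le h)))
  calc dilworthTruncation f F
      ≤ ∑ p ∈ (P.extend hFC.ne_empty hdisj (Finset.sdiff_union_inter F C)).parts, f p :=
        dilworthTruncation_le_sum_parts f _
    _ = f (F ∩ C) + dilworthTruncation f (F \ C) := by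
        rw [hP, Finpartition.extend_parts, Finset.sum_insert hnotMem]
    _ ≤ dilworthTruncation f (F \ C) + f C := by
        rw [add_comm]
        gcongr
        exact hf Finset.inter_subset_right

theorem dilworthTruncation_le_sdiff_biUnion_add_sum {κ : Type*}
    (hf : Monotone f) (s : Finset κ) (c : κ → Finset (Fin m))
    (hc : ∀ i ∈ s, 0 ≤ f (c i)) (F : Finset (Fin m)) :
    dilworthTruncation f F ≤ dilworthTruncation f (F \ s.biUnion c) + ∑ i ∈ s, f (c i) := by
  classical
  induction s using Finset.induction_on generalizing F with
  | empty => simp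
  | insert i s hi ih =>
    have hi0 := dilworthTruncation_le_sdiff_add hf (hc i (Finset.mem_insert_self i s)) F
    have hs := ih (fun j hj => hc j (Finset.mem_insert_of_mem hj)) (F \ c i)
    rw [sdiff_sdiff_left, Finset.sup_eq_union] at hs
    rw [Finset.biUnion_insert, Finset.sum_insert hi]
    linarith

theorem card_le_dilworthTruncation_of_subset (hf : Monotone f)
    (hf0 : ∀ I, I.Nonempty → 0 ≤ f I) (hAF : A ⊆ F)
    (hA : ∀ I ⊆ A, I.Nonempty → (#I : ℤ) ≤ f I) : (#A : ℤ) ≤ dilworthTruncation f F := by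
  obtain ⟨P, hP⟩ := exists_dilworthTruncation_eq_sum_parts f F
  have hAP : (P.parts.biUnion fun p => A ∩ p) = A := by
    have hPF : P.parts.biUnion (fun p => p) = F := P.biUnion_parts
    rw [← Finset.inter_biUnion, hPF, Finset.inter_eq_left.2 hAF]
  have hcard : #(P.parts.biUnion fun p => A ∩ p) ≤ ∑ p ∈ P.parts, #(A ∩ p) :=
    Finset.card_biUnion_le
  calc (#A : ℤ) ≤ ∑ p ∈ P.parts, (#(A ∩ p) : ℤ) := by
        rw [hAP] at hcard
        exact_mod_cast hcard
    _ ≤ ∑ p ∈ P.parts, f p := Finset.sum_le_sum fun p hp => ?_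
    _ = dilworthTruncation f F := hP.symm
  rcases (A ∩ p).eq_empty_or_nonempty with hAp | hAp
  · simpa [hAp] using hf0 p (P.nonempty_of_mem_parts hp)
  · exact (hA _ Finset.inter_subset_left hAp).trans (hf Finset.inter_subset_right)

theorem IsMonotoneSubmodular.insert_le_of_subset (hf : IsMonotoneSubmodular f) {b : Fin m}
    (hTU : T ⊆ U) (hT : f (insert b T) ≤ f T) : f (insert b U) ≤ f U := by
  have hsub := hf.submodular (insert b T) U
  have hmono := hf.monotone (Finset.subset_inter (Finset.subset_insert b T) hTU)
  rw [Finset.insert_union, Finset.union_eq_right.2 hTU] at hsub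
  linarith

theorem IsMonotoneSubmodular.union_le_of_forall_insert_le (hf : IsMonotoneSubmodular f)
    {S : Finset (Fin m)} (hS : ∀ b ∈ S, f (insert b U) ≤ f U) : f (U ∪ S) ≤ f U := by
  induction S using Finset.induction_on with
  | empty => simp
  | insert b S _ ih =>
    rw [Finset.union_insert]
    calc f (insert b (U ∪ S)) ≤ f (U ∪ S) :=
          hf.insert_le_of_subset Finset.subset_union_left (hS b (Finset.mem_insert_self b S))
      _ ≤ f U := ih fun a ha => hS a (Finset.mem_insert_of_mem ha)

/-- A nonempty subset `T` of `A` is tight if it attains the bound `#T ≤ f T` that defines the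
independence of `A` in the matroid induced by `f`. -/
structure IsTight (f : Finset (Fin m) → ℤ) (A T : Finset (Fin m)) : Prop where
  subset : T ⊆ A
  nonempty : T.Nonempty
  apply_eq_card : f T = #T

theorem IsTight.union (hf : IsMonotoneSubmodular f)
    (hA : ∀ I ⊆ A, I.Nonempty → (#I : ℤ) ≤ f I) (hT : IsTight f A T) (hU : IsTight f A U)
    (hTU : (T ∩ U).Nonempty) : IsTight f A (T ∪ U) := by
  have hsubset := Finset.union_subset hT.subset hU.subset
  have hnonempty : (T ∪ U).Nonempty := hT.nonempty.mono Finset.subset_union_left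
  refine ⟨hsubset, hnonempty, ?_⟩
  have hsub := hf.submodular T U
  have hinter := hA (T ∩ U) (Finset.inter_subset_left.trans hT.subset) hTU
  have hunion := hA (T ∪ U) hsubset hnonempty
  have hcard := Finset.card_union_add_card_inter T U
  have hfT := hT.apply_eq_card
  have hfU := hU.apply_eq_card
  omega

theorem disjoint_of_maximal_isTight (hf : IsMonotoneSubmodular f)
    (hA : ∀ I ⊆ A, I.Nonempty → (#I : ℤ) ≤ f I) (hT : Maximal (IsTight f A) T)
    (hU : Maximal (IsTight f A) U) (hTU : T ≠ U) : Disjoint T U := by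
  rw [Finset.disjoint_iff_inter_eq_empty]
  by_contra! hne
  have hunion := hT.prop.union hf hA hU.prop hne
  exact hTU ((hT.eq_of_le hunion Finset.subset_union_left).trans
    (hU.eq_of_le hunion Finset.subset_union_right).symm)

theorem IsTight.exists_maximal (hT : IsTight f A T) :
    ∃ U, T ⊆ U ∧ Maximal (IsTight f A) U :=
  (Set.toFinite {U | IsTight f A U}).exists_le_maximal hT

theorem exists_isTight_insert_le (hf : Monotone f)
    (hA : ∀ I ⊆ A, I.Nonempty → (#I : ℤ) ≤ f I) {b : Fin m} (hb : 0 < f {b})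
    (hbA : ¬ ∀ I ⊆ insert b A, I.Nonempty → (#I : ℤ) ≤ f I) :
    ∃ T, IsTight f A T ∧ f (insert b T) ≤ f T := by
  push Not at hbA
  obtain ⟨I, hI, hIne, hlt⟩ := hbA
  have hbI : b ∈ I := by
    by_contra hbI
    exact hlt.not_ge (hA I ((Finset.subset_insert_iff_of_notMem hbI).1 hI) hIne)
  have hIpos : 0 < f I := hb.trans_le (hf (Finset.singleton_subset_iff.2 hbI))
  have hcard := Finset.card_erase_add_one hbI
  have herase : (I.erase b).Nonempty := by rw [← Finset.card_pos]; omega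
  have hsubset : I.erase b ⊆ A := Finset.subset_insert_iff.1 hI
  have hmono := hf (Finset.erase_subset b I)
  have hle := hA _ hsubset herase
  exact ⟨I.erase b, ⟨hsubset, herase, by omega⟩, by rw [Finset.insert_erase hbI]; omega⟩

theorem exists_maximal_isTight_insert_le (hf : IsMonotoneSubmodular f)
    (hf1 : ∀ e, f {e} ≤ 1) (hA : ∀ I ⊆ A, I.Nonempty → (#I : ℤ) ≤ f I) {b : Fin m}
    (hb : 0 < f {b}) (hbA : b ∉ A → ¬ ∀ I ⊆ insert b A, I.Nonempty → (#I : ℤ) ≤ f I) :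
    ∃ U, Maximal (IsTight f A) U ∧ f (insert b U) ≤ f U := by
  obtain ⟨T, hT, hbT⟩ : ∃ T, IsTight f A T ∧ f (insert b T) ≤ f T := by
    by_cases hmem : b ∈ A
    · exact ⟨{b}, ⟨by simpa using hmem, by simp, by simpa using (hf1 b).antisymm hb⟩, by simp⟩
    · exact exists_isTight_insert_le hf.monotone hA hb (hbA hmem)
  obtain ⟨U, hTU, hU⟩ := hT.exists_maximal
  exact ⟨U, hU, hf.insert_le_of_subset hTU hbT⟩

theorem IsMonotoneSubmodular.dilworthTruncation_le_card (hf : IsMonotoneSubmodular f)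
    (hf1 : ∀ e, f {e} ≤ 1) (hA : ∀ I ⊆ A, I.Nonempty → (#I : ℤ) ≤ f I)
    (hmax : ∀ b ∈ F, b ∉ A → ¬ ∀ I ⊆ insert b A, I.Nonempty → (#I : ℤ) ≤ f I) :
    dilworthTruncation f F ≤ #A := by
  classical
  let M : Finset (Finset (Fin m)) := {U | Maximal (IsTight f A) U}
  let closure (U : Finset (Fin m)) : Finset (Fin m) := {b | f (insert b U) ≤ f U}
  have hM : ∀ U ∈ M, Maximal (IsTight f A) U := fun U hU => (Finset.mem_filter.1 hU).2
  have hclosure : ∀ U ∈ M, f (closure U) = #U := fun U hU => by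
    have hsubset : U ⊆ closure U := fun b hb => by simp [closure, Finset.insert_eq_of_mem hb]
    have hle := hf.union_le_of_forall_insert_le (U := U) (S := closure U) (by simp [closure])
    rw [Finset.union_eq_right.2 hsubset] at hle
    exact (hle.antisymm (hf.monotone hsubset)).trans (hM U hU).prop.apply_eq_card
  have hloop : ∀ b ∈ F \ M.biUnion closure, f {b} ≤ 0 := fun b hb => by
    rw [Finset.mem_sdiff] at hb
    by_contra! hpos
    obtain ⟨U, hU, hbU⟩ := exists_maximal_isTight_insert_le hf hf1 hA hpos (hmax b hb.1)
    exact hb.2 (Finset.mem_biUnion.2 ⟨U, by simpa [M] using hU, by simpa [closure] using hbU⟩)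
  calc dilworthTruncation f F
      ≤ dilworthTruncation f (F \ M.biUnion closure) + ∑ U ∈ M, f (closure U) :=
        dilworthTruncation_le_sdiff_biUnion_add_sum hf.monotone M closure
          (fun U hU => by simp [hclosure U hU]) F
    _ ≤ 0 + ∑ U ∈ M, (#U : ℤ) :=
        add_le_add ((dilworthTruncation_le_sum_singleton f _).trans (Finset.sum_nonpos hloop))
          (Finset.sum_le_sum fun U hU => (hclosure U hU).le)
    _ = #(M.biUnion id) := by
        rw [zero_add, Finset.card_biUnion (t := id) fun U hU W hW =>
          disjoint_of_maximal_isTight hf hA (hM U hU) (hM W hW)]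
        simp
    _ ≤ #A := by
        exact_mod_cast
          Finset.card_le_card (Finset.biUnion_subset.2 fun U hU => (hM U hU).prop.subset)

theorem toNat_eRk_inducedMatroid (hf : IsMonotoneSubmodular f) (hf0 : ∀ e, 0 ≤ f {e})
    (hf1 : ∀ e, f {e} ≤ 1) (F : Finset (Fin m)) :
    (((inducedMatroid f hf).eRk (F : Set (Fin m))).toNat : ℤ) = dilworthTruncation f F := by
  obtain ⟨B, hB⟩ := (inducedMatroid f hf).exists_isBasis' (F : Set (Fin m))
  lift B to Finset (Fin m) using B.toFinite
  have hindep := (inducedMatroid_indep_iff_forall_card_le hf).1 hB.indep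
  have hnonneg : ∀ I : Finset (Fin m), I.Nonempty → 0 ≤ f I := fun I ⟨e, he⟩ =>
    (hf0 e).trans (hf.monotone (Finset.singleton_subset_iff.2 he))
  rw [hB.eRk_eq_encard, Set.encard_coe_eq_coe_finsetCard, ENat.toNat_natCast]
  refine le_antisymm
    (card_le_dilworthTruncation_of_subset hf.monotone hnonneg (by exact_mod_cast hB.subset) hindep)
    (hf.dilworthTruncation_le_card hf1 hindep fun b hbF hbB hins => hbB ?_)
  rw [← inducedMatroid_indep_iff_forall_card_le hf, Finset.coe_insert] at hins
  exact_mod_cast hB.mem_of_insert_indep hbF hins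

end DilworthTruncation

section Jacobian

open MvPolynomial

variable {k R ι : Type*} [CommRing k]

theorem derivation_aeval_eq_sum [CommRing R] [Algebra k R] {M : Type*} [AddCommGroup M] [Module k M]
    [Module R M] [Fintype ι] (D : Derivation k R M) (φ : ι → R) (p : MvPolynomial ι k) :
    D (aeval φ p) = ∑ i, aeval φ (pderiv i p) • D (φ i) := by
  classical
  induction p using MvPolynomial.induction_on with
  | C a => simp
  | add p q hp hq => simp [hp, hq, add_smul, Finset.sum_add_distrib]
  | mul_X p j hp =>
    simp [hp, Pi.single_apply, add_smul, mul_smul, Finset.sum_add_distrib, Finset.smul_sum,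
      apply_ite (aeval φ), ite_smul]

theorem totalDegree_pderiv_lt {p : MvPolynomial ι k} (hp : p.totalDegree ≠ 0) (i : ι) :
    (pderiv i p).totalDegree < p.totalDegree := by
  refine (Finset.sup_lt_iff (Nat.pos_of_ne_zero hp)).2 fun s hs => ?_
  rw [mem_support_iff, coeff_pderiv] at hs
  have hle := le_totalDegree (mem_support_iff.2 (left_ne_zero_of_mul hs))
  rw [Finsupp.sum_add_index' (by simp) (by simp)] at hle
  simp only [Finsupp.sum_single_index, Order.add_one_le_iff] at hle
  omega

theorem eq_C_of_forall_pderiv_eq_zero [IsDomain k] [CharZero k] {p : MvPolynomial ι k}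
    (hp : ∀ i, pderiv i p = 0) : p = C (p.coeff 0) := by
  classical
  ext s
  rw [coeff_C]
  split_ifs with hs
  · rw [hs]
  obtain ⟨i, hi⟩ := Finsupp.ne_iff.1 (Ne.symm hs)
  have hle : Finsupp.single i 1 ≤ s := Finsupp.single_le_iff.2 (Nat.one_le_iff_ne_zero.2 hi)
  have hcoeff := congrArg (coeff (s - Finsupp.single i 1)) (hp i)
  rw [coeff_pderiv, tsub_add_cancel_of_le hle, coeff_zero] at hcoeff
  exact (mul_eq_zero.1 hcoeff).resolve_right (Nat.cast_add_one_ne_zero _)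

theorem algebraicIndependent_of_forall_derivation [IsDomain k] [CharZero k] [CommRing R]
    [Algebra k R] [FaithfulSMul k R] [Fintype ι] {φ : ι → R}
    (h : ∀ q : ι → R, (∀ D : Derivation k R R, ∑ i, q i * D (φ i) = 0) → q = 0) :
    AlgebraicIndependent k φ := by
  rw [algebraicIndependent_iff]
  intro p
  induction hn : p.totalDegree using Nat.strong_induction_on generalizing p with
  | _ n ih =>
  intro hp
  suffices hC : p = C (p.coeff 0) by
    rw [hC, aeval_C, map_eq_zero_iff _ (FaithfulSMul.algebraMap_injective k R)] at hp
    rw [hC, hp, map_zero]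
  by_cases hn0 : p.totalDegree = 0
  · exact totalDegree_eq_zero_iff_eq_C.1 hn0
  have hq := h (fun i => aeval φ (pderiv i p)) fun D => by
    simpa [hp] using (derivation_aeval_eq_sum D φ p).symm
  exact eq_C_of_forall_pderiv_eq_zero fun i =>
    ih _ (hn ▸ totalDegree_pderiv_lt hn0 i) _ rfl (congrFun hq i)

end Jacobian

section ScalingBound

variable {k K : Type*}

theorem card_le_card_of_algebraicIndependent_of_mem_adjoin [CommRing k] [IsDomain k] [CommRing K]
    [Algebra k K] {ι κ : Type*} [Fintype ι] [Fintype κ] {z : ι → K} {b : κ → K}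
    (hz : AlgebraicIndependent k z) (hb : ∀ i, z i ∈ Algebra.adjoin k (Set.range b)) :
    Fintype.card ι ≤ Fintype.card κ := by
  simp only [Algebra.adjoin_range_eq_range_aeval, AlgHom.mem_range] at hb
  choose p hp using hb
  have hp_indep : AlgebraicIndependent k p :=
    AlgebraicIndependent.of_comp (MvPolynomial.aeval b) (by simpa [Function.comp_def, hp] using hz)
  have htrdeg := hp_indep.lift_cardinalMk_le_trdeg
  rw [MvPolynomial.trdeg_of_isDomain, Cardinal.mk_fintype, Cardinal.mk_fintype] at htrdeg
  simpa using htrdeg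

variable [Field k] [Field K] [Algebra k K]

theorem card_le_finrank_of_algebraicIndependent_of_mem_adjoin {ι : Type*} [Fintype ι] {z : ι → K}
    (hz : AlgebraicIndependent k z) (U : Submodule k K) [FiniteDimensional k U]
    (hU : ∀ i, z i ∈ Algebra.adjoin k (U : Set K)) : Fintype.card ι ≤ Module.finrank k U := by
  let b := Module.finBasis k U
  have hspan : Submodule.span k (Set.range (U.subtype ∘ b)) = U := by
    rw [Set.range_comp, ← Submodule.map_span, b.span_eq, Submodule.map_subtype_top]
  rw [← Fintype.card_fin (Module.finrank k U)]
  refine card_le_card_of_algebraicIndependent_of_mem_adjoin (b := U.subtype ∘ b) hz fun i => ?_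
  rw [← Algebra.adjoin_span, hspan]
  exact hU i

/- Multiplying `V` by a scalar and `W` by its inverse does not change the products, so we may
assume `1 ∈ V`; the products then lie in the algebra generated by `W` and a complement of `1`. -/
theorem card_add_one_le_finrank_add_finrank {ι : Type*} [Fintype ι] [Nonempty ι] {v w : ι → K}
    (hvw : AlgebraicIndependent k fun i => v i * w i) (V W : Submodule k K)
    [FiniteDimensional k V] [FiniteDimensional k W] (hV : ∀ i, v i ∈ V) (hW : ∀ i, w i ∈ W) :
    Fintype.card ι + 1 ≤ Module.finrank k V + Module.finrank k W := by
  obtain ⟨i₀⟩ := ‹Nonempty ι›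
  have hv₀ : v i₀ ≠ 0 := left_ne_zero_of_mul (hvw.ne_zero i₀)
  let V' : Submodule k K := V.map (LinearMap.mulLeft k (v i₀)⁻¹)
  let W' : Submodule k K := W.map (LinearMap.mulLeft k (v i₀))
  have hone : k ∙ (1 : K) ≤ V' := (Submodule.span_singleton_le_iff_mem _ _).2
    ⟨v i₀, hV i₀, by simp [hv₀]⟩
  obtain ⟨C, hdisj, hC⟩ := IsModularLattice.exists_disjoint_and_sup_eq hone
  have : FiniteDimensional k C := Submodule.finiteDimensional_of_le (hC ▸ le_sup_right)
  have hCrank : Module.finrank k C + 1 = Module.finrank k V' := by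
    have hsum := Submodule.finrank_sup_add_finrank_inf_eq (k ∙ (1 : K)) C
    rw [hC, hdisj.eq_bot, finrank_bot, finrank_span_singleton one_ne_zero] at hsum
    omega
  let S := Algebra.adjoin k ((C ⊔ W' : Submodule k K) : Set K)
  have hsub : C ⊔ W' ≤ S.toSubmodule := Algebra.subset_adjoin
  have hV'S : V' ≤ S.toSubmodule := by
    rw [← hC, sup_le_iff, Submodule.span_singleton_le_iff_mem]
    exact ⟨S.one_mem, le_sup_left.trans hsub⟩
  have hmem : ∀ i, v i * w i ∈ S := fun i => by
    have hvi : (v i₀)⁻¹ * v i ∈ S := hV'S (Submodule.mem_map_of_mem (hV i))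
    have hwi : v i₀ * w i ∈ S := hsub (Submodule.mem_sup_right (Submodule.mem_map_of_mem (hW i)))
    convert! S.mul_mem hvi hwi using 1
    field_simp
  have hcard := card_le_finrank_of_algebraicIndependent_of_mem_adjoin hvw (C ⊔ W') hmem
  have hsup := Submodule.finrank_add_le_finrank_add_finrank C W'
  have hV' : Module.finrank k V' ≤ Module.finrank k V := Submodule.finrank_map_le _ _
  have hW' : Module.finrank k W' ≤ Module.finrank k W := Submodule.finrank_map_le _ _
  omega

end ScalingBound

section GenericPoint

variable {k V R κ : Type*} [CommRing k] [AddCommGroup V] [Module k V] [CommRing R] [Algebra k R]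

/-- A linear map `z : V → R`, seen as an `R`-valued point of the dual of `V`, is generic if every
displacement `Z : V → R` of `z` is induced by a derivation of `R`. -/
def IsGeneric (z : V →ₗ[k] R) : Prop :=
  ∀ Z : V →ₗ[k] R, ∃ D : Derivation k R R, ∀ v, D (z v) = Z v

theorem IsGeneric.apply_ne_zero [Module.Projective k V] [FaithfulSMul k R] {z : V →ₗ[k] R}
    (hz : IsGeneric z) {v : V} (hv : v ≠ 0) : z v ≠ 0 := by
  intro hzv
  obtain ⟨φ, hφ⟩ := Module.Projective.exists_dual_ne_zero k hv
  obtain ⟨D, hD⟩ := hz (Algebra.linearMap k R ∘ₗ φ)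
  have hDv : algebraMap k R (φ v) = 0 := by simpa [hzv] using (hD v).symm
  exact hφ ((FaithfulSMul.algebraMap_eq_zero_iff k R).1 hDv)

/-- The universal point of the dual of `V`: the elements of `V` as linear forms in the
coordinates with respect to the basis `b`. -/
noncomputable def linearForm (b : Module.Basis κ k V) : V →ₗ[k] MvPolynomial κ k :=
  b.constr k MvPolynomial.X

theorem isGeneric_linearForm (b : Module.Basis κ k V) : IsGeneric (linearForm b) := by
  intro Z
  let D := MvPolynomial.mkDerivation k (Z ∘ b)
  have hD : D.toLinearMap ∘ₗ linearForm b = Z := b.ext fun i => by simp [linearForm, D]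
  exact ⟨D, LinearMap.congr_fun hD⟩

theorem aeval_linearForm (b : Module.Basis κ k V) (z : V →ₗ[k] R) (v : V) :
    MvPolynomial.aeval (z ∘ b) (linearForm b v) = z v := by
  have hz : (MvPolynomial.aeval (z ∘ b)).toLinearMap ∘ₗ linearForm b = z :=
    b.ext fun i => by simp [linearForm]
  exact LinearMap.congr_fun hz v

end GenericPoint

section DifferentialRelation

variable {k A B R ι : Type*} [CommRing k] [AddCommGroup A] [Module k A] [AddCommGroup B]
  [Module k B] [CommRing R] [Algebra k R]

/-- The family `q` is a linear relation between the differentials of the products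
`x (α e) * y (β e)`, `e ∈ E`, where `x` and `y` vary in arbitrary directions `X` and `Y`. -/
def IsDifferentialRelation (x : A →ₗ[k] R) (y : B →ₗ[k] R) (α : ι → A) (β : ι → B) (E : Finset ι)
    (q : ι → R) : Prop :=
  ∀ (X : A →ₗ[k] R) (Y : B →ₗ[k] R),
    ∑ e ∈ E, q e * (y (β e) * X (α e) + x (α e) * Y (β e)) = 0

variable {x : A →ₗ[k] R} {y : B →ₗ[k] R} {α : ι → A} {β : ι → B} {E : Finset ι} {q : ι → R}
  {X : A →ₗ[k] R} {Y : B →ₗ[k] R}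

theorem IsDifferentialRelation.erase [DecidableEq ι] (hq : IsDifferentialRelation x y α β E q)
    {e₀ : ι} (he₀ : q e₀ = 0) : IsDifferentialRelation x y α β (E.erase e₀) q := fun X Y =>
  (Finset.sum_erase E (by rw [he₀, zero_mul])).trans (hq X Y)

theorem IsDifferentialRelation.tangent [IsDomain R] (hq : IsDifferentialRelation x y α β E q)
    {e₀ : ι} (he₀ : e₀ ∈ E) (hqe₀ : q e₀ ≠ 0)
    (hXY : ∀ e ∈ E, e ≠ e₀ → y (β e) * X (α e) + x (α e) * Y (β e) = 0) :
    y (β e₀) * X (α e₀) + x (α e₀) * Y (β e₀) = 0 := by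
  have hsum := hq X Y
  rw [Finset.sum_eq_single_of_mem e₀ he₀ fun e he hne => by rw [hXY e he hne, mul_zero]] at hsum
  exact (mul_eq_zero.1 hsum).resolve_left hqe₀

/- Apply a derivation that moves `x` and `y` in the second pair of directions to the relation in
the directions `X` and `Y`, and subtract the relation in the derivatives of `X` and `Y`. -/
theorem IsDifferentialRelation.sum_mul_eq_zero_of_tangent (hxy : IsGeneric (x.coprod y))
    (hq : IsDifferentialRelation x y α β E q)
    (hXY : ∀ e ∈ E, y (β e) * X (α e) + x (α e) * Y (β e) = 0) (X' : A →ₗ[k] R) (Y' : B →ₗ[k] R) :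
    ∑ e ∈ E, q e * (Y' (β e) * X (α e) + X' (α e) * Y (β e)) = 0 := by
  obtain ⟨D, hD⟩ := hxy (X'.coprod Y')
  have hDx : ∀ a, D (x a) = X' a := fun a => by simpa using hD (a, 0)
  have hDy : ∀ b, D (y b) = Y' b := fun b => by simpa using hD (0, b)
  have hDsum := congrArg D (hq X Y)
  rw [map_sum, map_zero, ← hq ((D : R →ₗ[k] R) ∘ₗ X) ((D : R →ₗ[k] R) ∘ₗ Y), ← sub_eq_zero,
    ← Finset.sum_sub_distrib] at hDsum
  rw [← hDsum]
  refine Finset.sum_congr rfl fun e he => ?_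
  simp only [Derivation.leibniz, map_add, hDx, hDy, smul_eq_mul, LinearMap.comp_apply,
    Derivation.coeFn_coe]
  linear_combination - D (q e) * hXY e he

/- Up to the factor `∏ f ∈ E, x (α f)`, the new coefficients are `q e * X (α e) / x (α e)`. -/
theorem IsDifferentialRelation.mul_tangent [DecidableEq ι] (hxy : IsGeneric (x.coprod y))
    (hq : IsDifferentialRelation x y α β E q)
    (hXY : ∀ e ∈ E, y (β e) * X (α e) + x (α e) * Y (β e) = 0) :
    IsDifferentialRelation x y α β E fun e => q e * X (α e) * ∏ f ∈ E.erase e, x (α f) := by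
  intro X' Y'
  rw [← mul_zero (∏ f ∈ E, x (α f)), ← hq.sum_mul_eq_zero_of_tangent hxy hXY (-X') Y',
    Finset.mul_sum]
  refine Finset.sum_congr rfl fun e he => ?_
  rw [← Finset.mul_prod_erase E (fun f => x (α f)) he, LinearMap.neg_apply]
  linear_combination (q e * (∏ f ∈ E.erase e, x (α f)) * X' (α e)) * hXY e he

end DifferentialRelation

section RelationVanishing

variable {k A B R ι : Type*} [Field k] [AddCommGroup A] [Module k A] [AddCommGroup B] [Module k B]
  [CommRing R] [Algebra k R] {x : A →ₗ[k] R} {y : B →ₗ[k] R} {α : ι → A} {β : ι → B} {E : Finset ι}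
  {q : ι → R}

theorem exists_linearMap_ne_zero_of_card_lt [IsDomain R] [FiniteDimensional k A]
    [FiniteDimensional k B] [Fintype ι]
    (hι : Fintype.card ι < Module.finrank k A + Module.finrank k B)
    (a : ι → A) (b : ι → B) (c d : ι → R) :
    ∃ (X : A →ₗ[k] R) (Y : B →ₗ[k] R), (X ≠ 0 ∨ Y ≠ 0) ∧
      ∀ e, c e * X (a e) + d e * Y (b e) = 0 := by
  let Φ : (A →ₗ[k] R) × (B →ₗ[k] R) →ₗ[R] (ι → R) := LinearMap.pi fun e =>
    (c e • LinearMap.applyₗ' R (a e)).coprod (d e • LinearMap.applyₗ' R (b e))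
  have hΦ : ¬ Function.Injective Φ := fun hinj => by
    have hle := LinearMap.finrank_le_finrank_of_injective hinj
    rw [Module.finrank_prod, Module.finrank_linearMap_self, Module.finrank_linearMap_self,
      Module.finrank_fintype_fun_eq_card] at hle
    exact hle.not_gt hι
  rw [← LinearMap.ker_eq_bot, Submodule.eq_bot_iff] at hΦ
  push Not at hΦ
  obtain ⟨⟨X, Y⟩, hXY, hne⟩ := hΦ
  refine ⟨X, Y, ?_, fun e => by simpa [Φ] using congrFun (LinearMap.mem_ker.1 hXY) e⟩
  contrapose! hne
  exact Prod.ext hne.1 hne.2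

theorem exists_extension_of_span_image (X : Submodule.span k (α '' E) →ₗ[k] R) :
    ∃ X' : A →ₗ[k] R, (∀ v : Submodule.span k (α '' E), X' v = X v) ∧
      (X ≠ 0 → ∃ e ∈ E, X' (α e) ≠ 0) := by
  obtain ⟨X', hX'⟩ := LinearMap.exists_extend X
  have hX'v : ∀ v : Submodule.span k (α '' E), X' v = X v := LinearMap.congr_fun hX'
  refine ⟨X', hX'v, fun hX => ?_⟩
  by_contra! h0
  refine hX (LinearMap.ext fun v => (hX'v v).symm.trans ?_)
  exact LinearMap.eqOn_span (g := (0 : A →ₗ[k] R)) (Set.forall_mem_image.2 h0) v.2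

theorem exists_directions_of_card_lt [IsDomain R]
    (hE : #E < Module.finrank k (Submodule.span k (α '' E)) +
      Module.finrank k (Submodule.span k (β '' E))) (c d : ι → R) :
    ∃ (X : A →ₗ[k] R) (Y : B →ₗ[k] R), (∀ e ∈ E, c e * X (α e) + d e * Y (β e) = 0) ∧
      ∃ e ∈ E, X (α e) ≠ 0 ∨ Y (β e) ≠ 0 := by
  have := FiniteDimensional.span_of_finite k (E.finite_toSet.image α)
  have := FiniteDimensional.span_of_finite k (E.finite_toSet.image β)
  let a (e : E) : Submodule.span k (α '' E) := ⟨α e, Submodule.subset_span ⟨e, e.2, rfl⟩⟩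
  let b (e : E) : Submodule.span k (β '' E) := ⟨β e, Submodule.subset_span ⟨e, e.2, rfl⟩⟩
  obtain ⟨X, Y, hne, hXY⟩ := exists_linearMap_ne_zero_of_card_lt (by simpa using hE) a b
    (fun e => c e) (fun e => d e)
  obtain ⟨X', hX', hXne⟩ := exists_extension_of_span_image X
  obtain ⟨Y', hY', hYne⟩ := exists_extension_of_span_image Y
  refine ⟨X', Y', fun e he => ?_, ?_⟩
  · simpa [a, b, ← hX', ← hY'] using hXY ⟨e, he⟩
  · rcases hne with hX | hY
    · obtain ⟨e, he, hXe⟩ := hXne hX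
      exact ⟨e, he, Or.inl hXe⟩
    · obtain ⟨e, he, hYe⟩ := hYne hY
      exact ⟨e, he, Or.inr hYe⟩

theorem IsDifferentialRelation.exists_tangent [IsDomain R]
    (hq : IsDifferentialRelation x y α β E q) {e₀ : ι} (he₀ : e₀ ∈ E) (hqe₀ : q e₀ ≠ 0)
    (hx : ∀ e ∈ E, x (α e) ≠ 0) (hE : #E < Module.finrank k (Submodule.span k (α '' E)) +
      Module.finrank k (Submodule.span k (β '' E))) :
    ∃ (X : A →ₗ[k] R) (Y : B →ₗ[k] R), X (α e₀) = 0 ∧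
      (∀ e ∈ E, y (β e) * X (α e) + x (α e) * Y (β e) = 0) ∧ ∃ e ∈ E, X (α e) ≠ 0 := by
  classical
  obtain ⟨X, Y, hXY, e, he, hne⟩ := exists_directions_of_card_lt hE
    (Function.update (fun e => y (β e)) e₀ 1) (Function.update (fun e => x (α e)) e₀ 0)
  have hXe₀ : X (α e₀) = 0 := by simpa using hXY e₀ he₀
  have htangent : ∀ e ∈ E, e ≠ e₀ → y (β e) * X (α e) + x (α e) * Y (β e) = 0 :=
    fun e he hne => by simpa [hne] using hXY e he
  have htangent' : ∀ e ∈ E, y (β e) * X (α e) + x (α e) * Y (β e) = 0 := fun e he => by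
    obtain rfl | hne := eq_or_ne e e₀
    · exact hq.tangent he₀ hqe₀ htangent
    · exact htangent e he hne
  refine ⟨X, Y, hXe₀, htangent', e, he, fun hXe => ?_⟩
  have hYe : Y (β e) = 0 := by simpa [hXe, hx e he] using htangent' e he
  exact hne.elim (absurd hXe) (absurd hYe)

theorem finrank_span_image_singleton_le_one (α : ι → A) (e : ι) :
    Module.finrank k (Submodule.span k (α '' {e})) ≤ 1 := by
  rw [Set.image_singleton]
  exact (finrank_span_le_card {α e}).trans (by simp)

theorem ne_zero_of_two_le_finrank_span_image_singleton {e : ι}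
    (he : 2 ≤ Module.finrank k (Submodule.span k (α '' {e})) +
      Module.finrank k (Submodule.span k (β '' {e}))) : α e ≠ 0 := by
  have hβe := finrank_span_image_singleton_le_one (k := k) β e
  intro hαe
  rw [Set.image_singleton, hαe, Submodule.span_zero_singleton, finrank_bot] at he
  omega

theorem IsDifferentialRelation.eq_zero [IsDomain R] (hxy : IsGeneric (x.coprod y))
    (hq : IsDifferentialRelation x y α β E q)
    (hE : ∀ I ⊆ E, I.Nonempty → #I + 1 ≤ Module.finrank k (Submodule.span k (α '' I)) +
      Module.finrank k (Submodule.span k (β '' I))) {e : ι} (he : e ∈ E) : q e = 0 := by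
  classical
  induction E using Finset.strongInduction generalizing q e with
  | H E ih =>
  have hpropagate : ∀ {q : ι → R}, IsDifferentialRelation x y α β E q → ∀ e₀ ∈ E, q e₀ = 0 →
      ∀ e ∈ E, q e = 0 := fun hq e₀ he₀ hqe₀ e he => by
    obtain rfl | hne := eq_or_ne e e₀
    · exact hqe₀
    · exact ih _ (Finset.erase_ssubset he₀) (hq.erase hqe₀)
        (fun I hI => hE I (hI.trans (Finset.erase_subset _ _))) (Finset.mem_erase.2 ⟨hne, he⟩)
  have hx : ∀ f ∈ E, x (α f) ≠ 0 := fun f hf => by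
    have hrank := hE {f} (Finset.singleton_subset_iff.2 hf) (Finset.singleton_nonempty f)
    rw [Finset.coe_singleton] at hrank
    have hαf : α f ≠ 0 := ne_zero_of_two_le_finrank_span_image_singleton hrank
    simpa using hxy.apply_ne_zero (v := (α f, 0)) (by simpa using hαf)
  by_contra hqe
  obtain ⟨X, Y, hXe, hXY, f, hf, hXf⟩ := hq.exists_tangent he hqe hx (hE E subset_rfl ⟨e, he⟩)
  have hqf : q f ≠ 0 := fun hqf => hqe (hpropagate hq f hf hqf e he)
  have hprod : ∏ g ∈ E.erase f, x (α g) ≠ 0 :=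
    Finset.prod_ne_zero_iff.2 fun g hg => hx g (Finset.mem_of_mem_erase hg)
  exact mul_ne_zero (mul_ne_zero hqf hXf) hprod
    (hpropagate (hq.mul_tangent hxy hXY) e he (by simp [hXe]) f hf)

end RelationVanishing

section AlgebraicIndependence

variable {k A B R ι : Type*} [Field k] [AddCommGroup A] [Module k A] [AddCommGroup B] [Module k B]
  [CommRing R] [IsDomain R] [Algebra k R] {x : A →ₗ[k] R} {y : B →ₗ[k] R} {α : ι → A} {β : ι → B}
  {E : Finset ι}

theorem algebraicIndependent_mul_of_card_add_one_le [CharZero k] (hxy : IsGeneric (x.coprod y))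
    (hE : ∀ I ⊆ E, I.Nonempty → #I + 1 ≤ Module.finrank k (Submodule.span k (α '' I)) +
      Module.finrank k (Submodule.span k (β '' I))) :
    AlgebraicIndependent k fun e : E => x (α e) * y (β e) := by
  classical
  refine algebraicIndependent_of_forall_derivation fun q hq => funext fun e => ?_
  let q' (e : ι) : R := if he : e ∈ E then q ⟨e, he⟩ else 0
  have hq' : IsDifferentialRelation x y α β E q' := fun X Y => by
    obtain ⟨D, hD⟩ := hxy (X.coprod Y)
    have hDx : ∀ a, D (x a) = X a := fun a => by simpa using hD (a, 0)
    have hDy : ∀ b, D (y b) = Y b := fun b => by simpa using hD (0, b)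
    rw [← hq D, ← Finset.sum_coe_sort]
    refine Finset.sum_congr rfl fun e _ => ?_
    simp only [q', e.2, dif_pos, Derivation.leibniz, hDx, hDy, smul_eq_mul]
    ring
  simpa [q'] using hq'.eq_zero hxy hE e.2

theorem card_add_one_le_of_algebraicIndependent_mul (hE : E.Nonempty)
    (hxy : AlgebraicIndependent k fun e : E => x (α e) * y (β e)) :
    #E + 1 ≤ Module.finrank k (Submodule.span k (α '' E)) +
      Module.finrank k (Submodule.span k (β '' E)) := by
  have := FiniteDimensional.span_of_finite k (E.finite_toSet.image α)
  have := FiniteDimensional.span_of_finite k (E.finite_toSet.image β)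
  have := hE.to_subtype
  let ψ := IsScalarTower.toAlgHom k R (FractionRing R)
  have hψ : AlgebraicIndependent k fun e : E => ψ (x (α e)) * ψ (y (β e)) := by
    simpa [Function.comp_def] using hxy.map' (f := ψ) (IsFractionRing.injective R (FractionRing R))
  have hcard := card_add_one_le_finrank_add_finrank hψ
    ((Submodule.span k (α '' E)).map (ψ.toLinearMap ∘ₗ x))
    ((Submodule.span k (β '' E)).map (ψ.toLinearMap ∘ₗ y))
    (fun e => Submodule.mem_map_of_mem (Submodule.subset_span ⟨e, e.2, rfl⟩))
    (fun e => Submodule.mem_map_of_mem (Submodule.subset_span ⟨e, e.2, rfl⟩))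
  rw [Fintype.card_coe] at hcard
  exact hcard.trans (add_le_add (Submodule.finrank_map_le _ _) (Submodule.finrank_map_le _ _))

theorem algebraicIndependent_mul_iff [CharZero k] (hxy : IsGeneric (x.coprod y)) :
    AlgebraicIndependent k (fun e : E => x (α e) * y (β e)) ↔
      ∀ I ⊆ E, I.Nonempty → #I + 1 ≤ Module.finrank k (Submodule.span k (α '' I)) +
        Module.finrank k (Submodule.span k (β '' I)) := by
  refine ⟨fun h I hI hIne => ?_, algebraicIndependent_mul_of_card_add_one_le hxy⟩
  exact card_add_one_le_of_algebraicIndependent_mul hIne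
    (h.comp (Set.inclusion hI) (Set.inclusion_injective hI))

end AlgebraicIndependence

section HadamardProduct

open MvPolynomial

theorem vanishingIdeal_domRestrict_zariskiClosure {σ : Type*} (S : Set (σ → ℂ)) (E : Set σ) :
    vanishingIdeal ℂ (E.domRestrict '' zariskiClosure S) =
      vanishingIdeal ℂ (E.domRestrict '' S) := by
  have hrename : ∀ (T : Set (σ → ℂ)) (p : MvPolynomial E ℂ),
      p ∈ vanishingIdeal ℂ (E.domRestrict '' T) ↔
        rename Subtype.val p ∈ vanishingIdeal ℂ T := fun T p => by
    simp only [mem_vanishingIdeal_iff, Set.forall_mem_image, aeval_rename]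
    rfl
  ext p
  rw [hrename, hrename, vanishingIdeal_zariskiClosure]

theorem vanishingIdeal_range_eval {k κ σ : Type*} [Field k] [Infinite k]
    (φ : σ → MvPolynomial κ k) :
    vanishingIdeal k (Set.range fun (c : κ → k) e => eval c (φ e)) = RingHom.ker (aeval φ) := by
  ext p
  have heval : ∀ c, aeval (fun e => eval c (φ e)) p = eval c (aeval φ p) := fun c => by
    simpa only [aeval_eq_eval] using (comp_aeval_apply φ (aeval c) p).symm
  simp only [mem_vanishingIdeal_iff, Set.forall_mem_range, heval, RingHom.mem_ker,
    MvPolynomial.funext_iff, map_zero]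

section DualProd

variable {k V W κ : Type*} [CommRing k] [AddCommGroup V] [Module k V] [AddCommGroup W] [Module k W]
  (b : Module.Basis κ k (Module.Dual k V × Module.Dual k W))

theorem eval_linearForm_dual_prod (x : V) (y : W) (a : Module.Dual k V × Module.Dual k W) :
    eval (fun i => (b i).1 x + (b i).2 y) (linearForm b a) = a.1 x + a.2 y := by
  rw [← coe_aeval_eq_eval]
  exact aeval_linearForm b ((Module.Dual.eval k V x).coprod (Module.Dual.eval k W y)) a

theorem exists_forall_dual_prod_basis_apply_eq [Module.IsReflexive k V] [Module.IsReflexive k W]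
    (c : κ → k) : ∃ (x : V) (y : W), ∀ i, (b i).1 x + (b i).2 y = c i := by
  obtain ⟨x, hx⟩ := (Module.evalEquiv k V).surjective (b.constr k c ∘ₗ LinearMap.inl k _ _)
  obtain ⟨y, hy⟩ := (Module.evalEquiv k W).surjective (b.constr k c ∘ₗ LinearMap.inr k _ _)
  refine ⟨x, y, fun i => ?_⟩
  have hxi : (b i).1 x = b.constr k c ((b i).1, 0) := LinearMap.congr_fun hx _
  have hyi : (b i).2 y = b.constr k c (0, (b i).2) := LinearMap.congr_fun hy _
  rw [hxi, hyi, ← map_add]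
  simp

end DualProd

variable {m : ℕ} (L₁ L₂ : Submodule ℂ (Fin m → ℂ))

theorem domRestrict_image_mul_eq_range_eval {κ : Type*}
    (b : Module.Basis κ ℂ (Module.Dual ℂ L₁ × Module.Dual ℂ L₂)) (F : Set (Fin m)) :
    F.domRestrict '' {z | ∃ x ∈ (L₁ : Set (Fin m → ℂ)), ∃ y ∈ (L₂ : Set (Fin m → ℂ)),
        z = fun j => x j * y j} =
      Set.range fun (c : κ → ℂ) (e : F) => eval c
        (linearForm b (coordinateForm L₁ e, 0) * linearForm b (0, coordinateForm L₂ e)) := by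
  have heval (x : L₁) (y : L₂) : (fun e : F => eval (fun i => (b i).1 x + (b i).2 y)
      (linearForm b (coordinateForm L₁ e, 0) * linearForm b (0, coordinateForm L₂ e))) =
        F.domRestrict fun j => (x : Fin m → ℂ) j * (y : Fin m → ℂ) j := by
    ext e
    rw [eval_mul, eval_linearForm_dual_prod, eval_linearForm_dual_prod, LinearMap.zero_apply,
      LinearMap.zero_apply, add_zero, zero_add]
    rfl
  refine Set.Subset.antisymm ?_ ?_
  · rintro _ ⟨_, ⟨x, hx, y, hy, rfl⟩, rfl⟩
    exact ⟨fun i => (b i).1 ⟨x, hx⟩ + (b i).2 ⟨y, hy⟩, heval ⟨x, hx⟩ ⟨y, hy⟩⟩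
  · rintro _ ⟨c, rfl⟩
    obtain ⟨x, y, hxy⟩ := exists_forall_dual_prod_basis_apply_eq b c
    obtain rfl := funext hxy
    exact ⟨_, ⟨x, x.2, y, y.2, rfl⟩, (heval x y).symm⟩

theorem algebraicMatroid_hadamardProduct_indep_iff (F : Finset (Fin m)) :
    (algebraicMatroid (hadamardProduct (L₁ : Set (Fin m → ℂ)) (L₂ : Set (Fin m → ℂ)))
      (hadamardProduct_irreducible L₁ L₂)).Indep (F : Set (Fin m)) ↔
      ∀ I ⊆ F, I.Nonempty → #I + 1 ≤ linearRank L₁ I + linearRank L₂ I := by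
  let b := Module.finBasis ℂ (Module.Dual ℂ L₁ × Module.Dual ℂ L₂)
  let x := linearForm b ∘ₗ LinearMap.inl ℂ (Module.Dual ℂ L₁) (Module.Dual ℂ L₂)
  let y := linearForm b ∘ₗ LinearMap.inr ℂ (Module.Dual ℂ L₁) (Module.Dual ℂ L₂)
  have hxy : IsGeneric (x.coprod y) :=
    (LinearMap.coprod_comp_inl_inr (linearForm b)).symm ▸ isGeneric_linearForm b
  have hindep := algebraicIndependent_mul_iff (E := F) (α := coordinateForm L₁)
    (β := coordinateForm L₂) hxy
  rw [algebraicMatroid_indep_iff, zariskiClosure_eq_univ_iff, hadamardProduct,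
    vanishingIdeal_domRestrict_zariskiClosure, domRestrict_image_mul_eq_range_eval L₁ L₂ b,
    vanishingIdeal_range_eval]
  exact algebraicIndependent_iff_ker_eq_bot.symm.trans hindep

theorem algebraicMatroid_hadamardProduct :
    algebraicMatroid (hadamardProduct (L₁ : Set (Fin m → ℂ)) (L₂ : Set (Fin m → ℂ)))
        (hadamardProduct_irreducible L₁ L₂) =
      inducedMatroid (fun F => (linearRank L₁ F : ℤ) + (linearRank L₂ F : ℤ) - 1)
        (isMonotoneSubmodular_rank_add_rank_sub_one L₁ L₂) := by
  refine Matroid.ext_indep rfl fun F _ => ?_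
  lift F to Finset (Fin m) using F.toFinite
  rw [algebraicMatroid_hadamardProduct_indep_iff, inducedMatroid_indep_iff_forall_card_le]
  exact forall₃_congr fun I _ _ => by omega

theorem linearRank_singleton_le_one (L : Submodule ℂ (Fin m → ℂ)) (e : Fin m) :
    linearRank L {e} ≤ 1 := by
  rw [linearRank, Finset.coe_singleton]
  exact finrank_span_image_singleton_le_one (coordinateForm L) e

theorem linearRank_singleton_eq_zero_iff {L : Submodule ℂ (Fin m → ℂ)} {e : Fin m} :
    linearRank L {e} = 0 ↔ L ≤ coordinateHyperplane e := by
  rw [linearRank, Submodule.finrank_eq_zero, Finset.coe_singleton, Set.image_singleton,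
    Submodule.span_singleton_eq_bot, LinearMap.ext_iff, SetLike.forall]
  rfl

end HadamardProduct

theorem mainTheorem1_general (m : ℕ) (L₁ L₂ : Submodule ℂ (Fin m → ℂ)) :
    algebraicMatroid (hadamardProduct (L₁ : Set (Fin m → ℂ)) (L₂ : Set (Fin m → ℂ)))
        (hadamardProduct_irreducible L₁ L₂) =
      inducedMatroid (fun F => (linearRank L₁ F : ℤ) + (linearRank L₂ F : ℤ) - 1)
        (isMonotoneSubmodular_rank_add_rank_sub_one L₁ L₂) ∧
    ((∀ e : Fin m, ¬ L₁ ⊔ L₂ ≤ coordinateHyperplane e) → ∀ F : Finset (Fin m),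
      (((algebraicMatroid (hadamardProduct (L₁ : Set (Fin m → ℂ)) (L₂ : Set (Fin m → ℂ)))
          (hadamardProduct_irreducible L₁ L₂)).eRk (F : Set (Fin m))).toNat : ℤ) =
        dilworthTruncation
          (fun F => (linearRank L₁ F : ℤ) + (linearRank L₂ F : ℤ) - 1) F) := by
  refine ⟨algebraicMatroid_hadamardProduct L₁ L₂, fun h F => ?_⟩
  rw [algebraicMatroid_hadamardProduct]
  refine toNat_eRk_inducedMatroid _ (fun e => ?_) (fun e => ?_) F
  · have hne := h e
    rw [sup_le_iff, ← linearRank_singleton_eq_zero_iff, ← linearRank_singleton_eq_zero_iff] at hne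
    omega
  · have hle₁ := linearRank_singleton_le_one L₁ e
    have hle₂ := linearRank_singleton_le_one L₂ e
    omega

theorem mainTheorem1 (m : ℕ) (L₁ L₂ : Submodule ℂ (Fin m → ℂ))
    (h₁ : ∀ e : Fin m, ¬ L₁ ≤ coordinateHyperplane e)
    (h₂ : ∀ e : Fin m, ¬ L₂ ≤ coordinateHyperplane e) :
    algebraicMatroid (hadamardProduct (L₁ : Set (Fin m → ℂ)) (L₂ : Set (Fin m → ℂ)))
        (hadamardProduct_irreducible L₁ L₂) =
      inducedMatroid (fun F => (linearRank L₁ F : ℤ) + (linearRank L₂ F : ℤ) - 1)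
        (isMonotoneSubmodular_rank_add_rank_sub_one L₁ L₂) ∧
    ∀ F : Finset (Fin m),
      (((algebraicMatroid (hadamardProduct (L₁ : Set (Fin m → ℂ)) (L₂ : Set (Fin m → ℂ)))
          (hadamardProduct_irreducible L₁ L₂)).eRk (F : Set (Fin m))).toNat : ℤ) =
        dilworthTruncation
          (fun F => (linearRank L₁ F : ℤ) + (linearRank L₂ F : ℤ) - 1) F :=
  (mainTheorem1_general m L₁ L₂).imp_right fun hrank =>
    hrank fun e h => h₁ e (le_sup_left.trans h)
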